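/- Let $P^n$ be a (nonempty) convex polytope of dimension $n\ge 0$ in a finite-dimensional real vector space. Faces are understood to be nonempty and to include $P^n$ itself. For $k\ge 0$ let $d_k$ be the operator on formal linear combinations of polytopes that sends an $r$-dimensional polytope $Q$ to the sum of all its $(r-k)$-dimensional faces (so $d_0=\mathrm{id}$ and $d_kQ=0$ for $k>r$). Put $\Phi(t)=\sum_{k\ge 0}t^k d_k$, let $\xi_\alpha$ be the linear map with $\xi_\alpha(Q)=\alpha^{\dim Q}$, and for $m\ge 1$ define the polynomial $$f_m(\alpha,t_1,\dots,t_m)(P^n)=\xi_\alpha\,\Phi(t_m)\cdots\Phi(t_1)P^n\in\mathbb Z[\alpha,t_1,\dots,t_m].$$ Then $f_1$ is the usual homogeneous $f$-polynomial in two variables, $f_1(\alpha,t)(P^n)=\sum_{i=0}^n f_i\,\alpha^i t^{\,n-i}$, where $f_i$ is the number of $i$-dimensional faces of $P^n$. Moreover, for every $m\ge 2$, the identity $$f_m(\alpha,t_1,\dots,t_m)(P^n)=f_1(\alpha,t_1+\dots+t_m)(P^n)$$ holds in $\mathbb Z[\alpha,t_1,\dots,t_m]$ if and only if $P^n$ is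 simple, that is, every vertex of $P^n$ lies in exactly $n$ facets. -/

import Mathlib

/-- A (nonempty) convex polytope in a real normed space `E`: the convex hull of finitely many
points. -/
@[ext]
structure Polytope (E : Type*) [NormedAddCommGroup E] [NormedSpace ℝ E] where
  carrier : Set E
  nonempty : carrier.Nonempty
  exists_finite_hull : ∃ S : Set E, S.Finite ∧ carrier = convexHull ℝ S

namespace Polytope

noncomputable section

variable {E : Type*} [NormedAddCommGroup E] [NormedSpace ℝ E]

/-- The dimension of a polytope: the dimension of its affine hull. -/
def dim (P : Polytope E) : ℕ := Module.finrank ℝ (vectorSpan ℝ P.carrier)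

/-- `F.IsFaceOf P`: the polytope `F` is the set of maximizers on `P` of some linear functional.
The polytope `P` itself is a face (zero functional); the empty set is not a `Polytope`. -/
def IsFaceOf (F P : Polytope E) : Prop := IsExposed ℝ P.carrier F.carrier

/-- A polytope has only finitely many faces. -/
theorem finite_isFaceOf (P : Polytope E) : {F : Polytope E | F.IsFaceOf P}.Finite := by
  obtain ⟨S, hS, hP⟩ := P.exists_finite_hull
  have hcomp : IsCompact P.carrier := by rw [hP]; exact hS.isCompact_convexHull (𝕜 := ℝ)
  have hinj : Function.Injective (Polytope.carrier : Polytope E → Set E) :=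
    fun A B h => Polytope.ext h
  refine Set.Finite.of_finite_image (f := Polytope.carrier) ?_ hinj.injOn
  refine (hS.finite_subsets.image (fun T => convexHull ℝ T)).subset ?_
  rintro _ ⟨F, hF, rfl⟩
  have hF' : IsExposed ℝ P.carrier F.carrier := hF
  have hconv : Convex ℝ P.carrier := by rw [hP]; exact convex_convexHull ℝ S
  have hsub : F.carrier.extremePoints ℝ ⊆ S := by
    refine (hF'.isExtreme.extremePoints_subset_extremePoints).trans ?_
    rw [hP]; exact extremePoints_convexHull_subset
  refine ⟨F.carrier.extremePoints ℝ, hsub, ?_⟩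
  have hkm := closure_convexHull_extremePoints (hF'.isCompact hcomp) (hF'.convex hconv)
  rwa [((hS.subset hsub).isCompact_convexHull (𝕜 := ℝ)).isClosed.closure_eq] at hkm

/-- The faces of `P` of codimension `k`, i.e. of dimension `dim P - k` (none if `k > dim P`). -/
def codimFaces (P : Polytope E) (k : ℕ) : Finset (Polytope E) :=
  (P.finite_isFaceOf.subset
    (show {F : Polytope E | F.IsFaceOf P ∧ F.dim + k = P.dim} ⊆ _ from fun _ h => h.1)).toFinset

/-- The faces of `P` of dimension `i`. -/
def dimFaces (P : Polytope E) (i : ℕ) : Finset (Polytope E) :=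
  (P.finite_isFaceOf.subset
    (show {F : Polytope E | F.IsFaceOf P ∧ F.dim = i} ⊆ _ from fun _ h => h.1)).toFinset

/-- An `n`-dimensional polytope is simple if each of its vertices (`0`-dimensional faces) lies in
exactly `n` facets (faces of codimension `1`). -/
def IsSimple (P : Polytope E) : Prop :=
  ∀ V ∈ P.dimFaces 0, {F | F ∈ P.codimFaces 1 ∧ V.carrier ⊆ F.carrier}.ncard = P.dim

section Operators

variable (R : Type*) [CommRing R]

/-- The operator `d_k`, extended linearly to formal `R`-linear combinations of polytopes:
`d_k P` is the sum of all faces of `P` of dimension `dim P - k`. -/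
def d (k : ℕ) : Module.End R (Polytope E →₀ R) :=
  Finsupp.linearCombination R (fun P => ∑ F ∈ P.codimFaces k, Finsupp.single F 1)

variable {R}

/-- The operator `Φ(t) = ∑ₖ tᵏ d_k`. The sum over `k` is cut at the dimension of the ambient
space: the remaining `d_k` vanish, see `d_eq_zero`. -/
def Phi (t : R) : Module.End R (Polytope E →₀ R) :=
  ∑ k ∈ Finset.range (Module.finrank ℝ E + 1), t ^ k • d R k

/-- The character `ξ_α`, `P ↦ α ^ dim P`, extended linearly. -/
def xi (α : R) : (Polytope E →₀ R) →ₗ[R] R :=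
  Finsupp.linearCombination R (fun P => α ^ P.dim)

variable (R) in
theorem d_eq_zero [FiniteDimensional ℝ E] {k : ℕ} (hk : Module.finrank ℝ E < k) :
    (d R k : Module.End R (Polytope E →₀ R)) = 0 := by
  have h : ∀ P : Polytope E, P.codimFaces k = ∅ := by
    intro P
    ext F
    have h1 : P.dim ≤ Module.finrank ℝ E := Submodule.finrank_le _
    simp only [codimFaces, Set.Finite.mem_toFinset, Set.mem_ofPred_eq, Finset.notMem_empty,
      iff_false, not_and]
    intro _ h2
    omega
  ext P
  simp [d, h]

end Operators

/-- The generalized `f`-polynomial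
`f_m(α, t₁, …, t_m)(P) = ξ_α Φ(t_m) ⋯ Φ(t₁) P ∈ ℤ[α, t₁, …, t_m]`.
The variable `X 0` is `α` and `X i.succ`, for `i : Fin m`, are `t₁, …, t_m`. -/
def genFPoly (m : ℕ) (P : Polytope E) : MvPolynomial (Fin (m + 1)) ℤ :=
  xi (MvPolynomial.X 0)
    ((List.ofFn fun i : Fin m => Phi (E := E)
        (MvPolynomial.X i.succ : MvPolynomial (Fin (m + 1)) ℤ)).reverse.prod
      (Finsupp.single P 1))

/-- The usual homogeneous `f`-polynomial `∑ᵢ fᵢ αⁱ tⁿ⁻ⁱ` of an `n`-dimensional polytope, where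
`fᵢ` is the number of `i`-dimensional faces; `X 0` is `α` and `X 1` is `t`. -/
def homFPoly (P : Polytope E) : MvPolynomial (Fin 2) ℤ :=
  ∑ i ∈ Finset.range (P.dim + 1),
    MvPolynomial.C ((P.dimFaces i).card : ℤ) * MvPolynomial.X 0 ^ i *
      MvPolynomial.X 1 ^ (P.dim - i)

/-- The substitution `g(α, t) ↦ g(α, t₁ + ⋯ + t_m)`. -/
def substSum (m : ℕ) : MvPolynomial (Fin 2) ℤ →ₐ[ℤ] MvPolynomial (Fin (m + 1)) ℤ :=
  MvPolynomial.aeval ![MvPolynomial.X 0, ∑ i : Fin m, MvPolynomial.X i.succ]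

end

end Polytope

namespace Polytope

variable {E : Type*} [NormedAddCommGroup E] [NormedSpace ℝ E]

/-! Expanding the operators turns `f_m` into a weighted sum over flags `P ⊇ F₁ ⊇ ⋯ ⊇ F_m` of faces
(`flagSum`). For `m = 2`, fix the smaller face `F` and sum over the faces `G` between `F` and `P`:
the coefficient of `α ^ dim F` contributed by `F` is `∑ t₁ ^ (dim P - dim G) * t₂ ^ (dim G - dim
F)`.

If `P` is simple, the faces containing `F` correspond to the subsets of the `dim P - dim F` facets
through `F`, so this sum is a binomial expansion (`IsSimple.sum_pow_mul_pow`). Faces of simple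
polytopes are simple, and induction on `m` follows.

Conversely, put `α = 0`, `t₁ = X`, `t₂ = 1` and the other variables `0`. Comparing linear
coefficients, the number of vertex-facet incidences is `dim P` times the number of vertices. Every
vertex lies in at least `dim P` facets (`dim_le_card_facetsThrough_add`), so equality holds at each
vertex.

The geometric input is that a face is cut out by the facets containing it
(`IsFaceOf.exists_facet_notMem`), proved by rotating supporting hyperplanes. -/

theorem convex (P : Polytope E) : Convex ℝ P.carrier := by
  obtain ⟨S, -, hP⟩ := P.exists_finite_hull
  rw [hP]; exact convex_convexHull ℝ S

theorem isCompact (P : Polytope E) : IsCompact P.carrier := by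
  obtain ⟨S, hS, hP⟩ := P.exists_finite_hull
  rw [hP]; exact hS.isCompact_convexHull (𝕜 := ℝ)

theorem exists_carrier_eq_of_isExposed {P : Polytope E} {A : Set E}
    (hA : IsExposed ℝ P.carrier A) (hne : A.Nonempty) : ∃ F : Polytope E, F.carrier = A := by
  obtain ⟨S, hS, hP⟩ := P.exists_finite_hull
  have hsub : A.extremePoints ℝ ⊆ S := by
    refine (hA.isExtreme.extremePoints_subset_extremePoints).trans ?_
    rw [hP]; exact extremePoints_convexHull_subset
  have hkm := closure_convexHull_extremePoints (hA.isCompact P.isCompact) (hA.convex P.convex)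
  rw [((hS.subset hsub).isCompact_convexHull (𝕜 := ℝ)).isClosed.closure_eq] at hkm
  exact ⟨⟨A, hne, _, hS.subset hsub, hkm.symm⟩, rfl⟩

/-- A linear functional bounded on the generators of a polytope is bounded on the polytope. -/
theorem le_of_forall_mem_le {P : Polytope E} {S : Set E} (hP : P.carrier = convexHull ℝ S)
    (l : StrongDual ℝ E) {c : ℝ} (h : ∀ p ∈ S, l p ≤ c) : ∀ p ∈ P.carrier, l p ≤ c := by
  intro p hp
  rw [hP] at hp
  exact convexHull_min (t := {x | l x ≤ c}) h
    (convex_halfSpace_le l.toLinearMap.isLinear c) hp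

/-! ### Faces and their supporting functionals -/

theorem isFaceOf_of_forall_mem_iff {F P : Polytope E} (l : StrongDual ℝ E) {c : ℝ}
    (hmax : ∀ y ∈ P.carrier, l y ≤ c)
    (h : ∀ x, x ∈ F.carrier ↔ x ∈ P.carrier ∧ l x = c) : F.IsFaceOf P := by
  intro _
  obtain ⟨v, hv⟩ := F.nonempty
  have hv' := (h v).1 hv
  refine ⟨l, ?_⟩
  ext x
  rw [h]
  constructor
  · rintro ⟨hx, hl⟩
    exact ⟨hx, fun y hy => hl ▸ hmax y hy⟩
  · rintro ⟨hx, hl⟩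
    exact ⟨hx, le_antisymm (hmax x hx) (hv'.2 ▸ hl v hv'.1)⟩

theorem IsFaceOf.exists_functional {F P : Polytope E} (h : F.IsFaceOf P) {v : E}
    (hv : v ∈ F.carrier) : ∃ l : StrongDual ℝ E, (∀ y ∈ P.carrier, l y ≤ l v) ∧
      ∀ x, x ∈ F.carrier ↔ x ∈ P.carrier ∧ l x = l v := by
  obtain ⟨l, hl⟩ := h F.nonempty
  have hv' : v ∈ P.carrier ∧ ∀ y ∈ P.carrier, l y ≤ l v := by rw [hl] at hv; exact hv
  refine ⟨l, hv'.2, fun x => ?_⟩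
  rw [hl]
  constructor
  · rintro ⟨hx, hm⟩
    exact ⟨hx, le_antisymm (hv'.2 x hx) (hm v hv'.1)⟩
  · rintro ⟨hx, hm⟩
    exact ⟨hx, fun y hy => hm ▸ hv'.2 y hy⟩

theorem exists_isFaceOf {P : Polytope E} (l : StrongDual ℝ E) {v : E} (hv : v ∈ P.carrier)
    (hmax : ∀ y ∈ P.carrier, l y ≤ l v) :
    ∃ F : Polytope E, F.IsFaceOf P ∧ ∀ x, x ∈ F.carrier ↔ x ∈ P.carrier ∧ l x = l v := by
  have hexp : IsExposed ℝ P.carrier {x | x ∈ P.carrier ∧ ∀ y ∈ P.carrier, l y ≤ l x} :=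
    fun _ => ⟨l, rfl⟩
  obtain ⟨F, hF⟩ := exists_carrier_eq_of_isExposed hexp ⟨v, hv, hmax⟩
  have hx : ∀ x, x ∈ F.carrier ↔ x ∈ P.carrier ∧ l x = l v := by
    intro x
    rw [hF]
    constructor
    · rintro ⟨hx, hm⟩
      exact ⟨hx, le_antisymm (hmax x hx) (hm v hv)⟩
    · rintro ⟨hx, hm⟩
      exact ⟨hx, fun y hy => hm ▸ hmax y hy⟩
  exact ⟨F, isFaceOf_of_forall_mem_iff l hmax hx, hx⟩

theorem IsFaceOf.refl (P : Polytope E) : P.IsFaceOf P := IsExposed.refl _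

theorem IsFaceOf.subset {F P : Polytope E} (h : F.IsFaceOf P) : F.carrier ⊆ P.carrier :=
  IsExposed.subset h

theorem IsFaceOf.mono {F G P : Polytope E} (hF : F.IsFaceOf P) (hG : G.IsFaceOf P)
    (h : F.carrier ⊆ G.carrier) : F.IsFaceOf G :=
  IsExposed.mono hF hG.subset h

/-- If `l` cuts `G` out of `P` and `g` cuts `F` out of `G`, then `g` plus a large multiple of `l`
cuts `F` out of `P`; finitely many generators make a uniform multiple possible. -/
theorem IsFaceOf.trans {F G P : Polytope E} (hF : F.IsFaceOf G) (hG : G.IsFaceOf P) :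
    F.IsFaceOf P := by
  obtain ⟨v, hv⟩ := F.nonempty
  obtain ⟨g, hg, hFg⟩ := hF.exists_functional hv
  obtain ⟨l, hl, hGl⟩ := hG.exists_functional (hF.subset hv)
  obtain ⟨S, hS, hP⟩ := P.exists_finite_hull
  have hSP : S ⊆ P.carrier := hP ▸ subset_convexHull ℝ S
  -- The ratio matters only for generators off `G`; on `G` its denominator vanishes and its value is
  -- not used.
  obtain ⟨M, hM⟩ := (hS.image fun p => (g p - g v) / (l v - l p)).bddAbove
  set N := max M 0
  have hN : ∀ p ∈ P.carrier, (N • l + g) p ≤ N * l v + g v := by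
    refine le_of_forall_mem_le hP _ fun p hp => ?_
    have hlp := hl p (hSP hp)
    simp only [add_apply, smul_apply, smul_eq_mul]
    rcases hlp.eq_or_lt with h | h
    · have := hg p ((hGl p).2 ⟨hSP hp, h⟩)
      rw [h]; linarith
    · have h1 : (g p - g v) / (l v - l p) ≤ N :=
        (hM (Set.mem_image_of_mem _ hp)).trans (le_max_left _ _)
      rw [div_le_iff₀ (by linarith)] at h1
      linarith
  simp only [add_apply, smul_apply, smul_eq_mul] at hN
  -- The multiple `N` already gives the bound; the extra `l` forces any maximizer to satisfy `l x =
  -- l v`, hence to lie in `G`.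
  refine isFaceOf_of_forall_mem_iff ((N + 1) • l + g) (c := (N + 1) * l v + g v) ?_ ?_
  · intro y hy
    have h1 := hN y hy
    have h2 := hl y hy
    simp only [add_apply, smul_apply, smul_eq_mul]
    linarith
  · intro x
    rw [hFg, hGl]
    simp only [add_apply, smul_apply, smul_eq_mul]
    constructor
    · rintro ⟨⟨hx, h1⟩, h2⟩
      exact ⟨hx, by rw [h1, h2]⟩
    · rintro ⟨hx, h1⟩
      have h2 := hN x hx
      have h3 := hl x hx
      have h4 : l x = l v := by linarith
      rw [h4] at h1
      exact ⟨⟨hx, h4⟩, by linarith⟩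

theorem dim_lt_of_isFaceOf_of_ne [FiniteDimensional ℝ E] {F P : Polytope E} (h : F.IsFaceOf P)
    (hne : F ≠ P) : F.dim < P.dim := by
  obtain ⟨v, hv⟩ := F.nonempty
  obtain ⟨l, -, hF⟩ := h.exists_functional hv
  obtain ⟨x, hx, hxF⟩ : ∃ x ∈ P.carrier, x ∉ F.carrier := by
    by_contra! hcon
    exact hne (Polytope.ext (h.subset.antisymm hcon))
  refine Submodule.finrank_lt_finrank_of_lt
    (lt_of_le_of_ne (vectorSpan_mono ℝ h.subset) fun heq => ?_)
  have hker : vectorSpan ℝ F.carrier ≤ LinearMap.ker l.toLinearMap := by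
    refine Submodule.span_le.2 ?_
    rintro _ ⟨a, ha, b, hb, rfl⟩
    simp [((hF a).1 ha).2, ((hF b).1 hb).2]
  have hmem : x -ᵥ v ∈ vectorSpan ℝ P.carrier := vsub_mem_vectorSpan ℝ hx (h.subset hv)
  have h0 : l (x - v) = 0 := hker (heq ▸ hmem)
  exact hxF ((hF x).2 ⟨hx, by rw [map_sub] at h0; linarith⟩)

theorem dim_le_of_isFaceOf [FiniteDimensional ℝ E] {F P : Polytope E} (h : F.IsFaceOf P) :
    F.dim ≤ P.dim :=
  Submodule.finrank_mono (vectorSpan_mono ℝ h.subset)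

/-! ### Rotation of hyperplanes; faces as intersections of facets -/

/-- Rotating a supporting hyperplane about a face until it hits a new point of the polytope. -/
theorem exists_rotation {P : Polytope E} {l g : StrongDual ℝ E} {v x : E}
    (hmax : ∀ y ∈ P.carrier, l y ≤ l v) (hconst : ∀ y ∈ P.carrier, l y = l v → g y = g v)
    (hx : x ∈ P.carrier) (hgx : g v < g x) :
    ∃ s : ℝ, 0 < s ∧ (∀ y ∈ P.carrier, (l + s • g) y ≤ (l + s • g) v) ∧
      ∃ y ∈ P.carrier, l y < l v ∧ (l + s • g) y = (l + s • g) v := by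
  obtain ⟨S, hS, hP⟩ := P.exists_finite_hull
  have hSP : S ⊆ P.carrier := hP ▸ subset_convexHull ℝ S
  have hT : {p ∈ S | g v < g p}.Nonempty := by
    by_contra hcon
    rw [Set.not_nonempty_iff_eq_empty] at hcon
    have h1 : ∀ p ∈ S, g p ≤ g v := by
      intro p hp
      by_contra! hlt
      exact Set.eq_empty_iff_forall_notMem.1 hcon p ⟨hp, hlt⟩
    exact absurd (le_of_forall_mem_le hP g h1 x hx) (not_le.2 hgx)
  -- The minimal ratio is the rotation parameter at which the hyperplane first meets a generator
  -- with `g` above `g v`.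
  obtain ⟨q, ⟨hqS, hq⟩, hmin⟩ := Set.exists_min_image _ (fun p => (l v - l p) / (g p - g v))
    (hS.subset fun _ h => h.1) hT
  have hlq : l q < l v := by
    refine lt_of_le_of_ne (hmax q (hSP hqS)) fun h => ?_
    exact absurd (hconst q (hSP hqS) h) hq.ne'
  have hs : 0 < (l v - l q) / (g q - g v) := div_pos (by linarith) (by linarith)
  refine ⟨_, hs, le_of_forall_mem_le hP _ fun p hp => ?_, q, hSP hqS, hlq, ?_⟩
  · simp only [add_apply, smul_apply, smul_eq_mul]
    rcases le_or_gt (g p) (g v) with h | h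
    · have := hmax p (hSP hp)
      nlinarith
    · have h1 := hmin p ⟨hp, h⟩
      rw [le_div_iff₀ (by linarith)] at h1
      linarith
  · simp only [add_apply, smul_apply, smul_eq_mul]
    have : g q - g v ≠ 0 := by linarith
    field_simp
    ring

/-- Modulo the direction space of `F`, the vectors from `v` into `P` span at least two dimensions,
so independent `x - v` and `y - v` can be given the values `1` and `-1`. The two signs allow
rotation in both directions. -/
theorem exists_functional_separating [FiniteDimensional ℝ E] {F P : Polytope E}
    (hd : F.dim + 2 ≤ P.dim) {v : E} (hvP : v ∈ P.carrier) :
    ∃ g : StrongDual ℝ E, (∀ a ∈ F.carrier, ∀ b ∈ F.carrier, g a = g b) ∧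
      ∃ x ∈ P.carrier, ∃ y ∈ P.carrier, g v < g x ∧ g y < g v := by
  have key : ∀ D : Submodule ℝ E, Module.finrank ℝ D < P.dim →
      ∃ x ∈ P.carrier, x - v ∉ D := by
    intro D hD
    by_contra! hcon
    have : vectorSpan ℝ P.carrier ≤ D := by
      rw [vectorSpan_eq_span_vsub_set_right ℝ hvP, Submodule.span_le]
      rintro _ ⟨x, hx, rfl⟩
      exact hcon x hx
    exact absurd (Submodule.finrank_mono this) (not_le.2 hD)
  set D := vectorSpan ℝ F.carrier with hDdef
  have hDdim : Module.finrank ℝ D = F.dim := rfl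
  obtain ⟨x, hx, hxD⟩ := key D (by omega)
  obtain ⟨y, hy, hyD⟩ := key (D ⊔ Submodule.span ℝ {x - v}) (by
    have h1 := Submodule.finrank_add_le_finrank_add_finrank D (Submodule.span ℝ {x - v})
    have h2 : Module.finrank ℝ (Submodule.span ℝ {x - v}) ≤ 1 := by
      simpa using finrank_span_le_card (R := ℝ) ({x - v} : Set E)
    omega)
  obtain ⟨g₂, hg₂x, hg₂⟩ := Submodule.exists_le_ker_of_notMem hxD
  obtain ⟨g₁, hg₁y, hg₁⟩ := Submodule.exists_le_ker_of_notMem hyD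
  have h1x : g₁ (x - v) = 0 :=
    hg₁ (Submodule.mem_sup_right (Submodule.mem_span_singleton_self _))
  -- Normalize `g₂` to be `1` at `x - v`, then correct the value at `y - v` to `-1` by a multiple of
  -- `g₁`, which vanishes at `x - v`.
  let g : E →ₗ[ℝ] ℝ := (g₂ (x - v))⁻¹ • g₂ -
    (((g₂ (x - v))⁻¹ * g₂ (y - v) + 1) / g₁ (y - v)) • g₁
  have hgx : g (x - v) = 1 := by
    simp only [g, LinearMap.sub_apply, LinearMap.smul_apply, smul_eq_mul, h1x, mul_zero, sub_zero]
    exact inv_mul_cancel₀ hg₂x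
  have hgy : g (y - v) = -1 := by
    simp only [g, LinearMap.sub_apply, LinearMap.smul_apply, smul_eq_mul]
    field_simp
    ring
  rw [map_sub] at hgx hgy
  refine ⟨g.toContinuousLinearMap, fun a ha b hb => ?_, x, hx, y, hy, ?_, ?_⟩
  · have hab : a - b ∈ D := vsub_mem_vectorSpan ℝ ha hb
    have e1 : g₁ (a - b) = 0 := hg₁ (Submodule.mem_sup_left hab)
    have e2 : g₂ (a - b) = 0 := hg₂ hab
    have : g (a - b) = 0 := by simp [g, e1, e2]
    rw [map_sub] at this
    simp only [LinearMap.coe_toContinuousLinearMap']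
    linarith
  · simp only [LinearMap.coe_toContinuousLinearMap']
    linarith
  · simp only [LinearMap.coe_toContinuousLinearMap']
    linarith

/-- A face of codimension at least two is the intersection of two strictly larger proper faces. -/
theorem IsFaceOf.exists_inter_eq [FiniteDimensional ℝ E] {F P : Polytope E} (h : F.IsFaceOf P)
    (hd : F.dim + 2 ≤ P.dim) : ∃ G G' : Polytope E, G.IsFaceOf P ∧ G'.IsFaceOf P ∧
      G ≠ F ∧ G' ≠ F ∧ G.carrier ∩ G'.carrier = F.carrier := by
  obtain ⟨v, hv⟩ := F.nonempty
  have hvP := h.subset hv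
  obtain ⟨l, hl, hF⟩ := h.exists_functional hv
  obtain ⟨g, hg, x, hx, y, hy, hgx, hgy⟩ := exists_functional_separating hd hvP
  obtain ⟨s, hs, hmax, p, hp, hlp, hpe⟩ := exists_rotation (g := g) hl
    (fun z hz hlz => hg z ((hF z).2 ⟨hz, hlz⟩) v hv) hx hgx
  obtain ⟨s', hs', hmax', p', hp', hlp', hpe'⟩ := exists_rotation (g := -g) hl
    (fun z hz hlz => by
      simp only [neg_apply]; rw [hg z ((hF z).2 ⟨hz, hlz⟩) v hv]) hy
    (by simpa using hgy)
  obtain ⟨G, hGP, hG⟩ := exists_isFaceOf _ hvP hmax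
  obtain ⟨G', hGP', hG'⟩ := exists_isFaceOf _ hvP hmax'
  refine ⟨G, G', hGP, hGP', ?_, ?_, ?_⟩
  · rintro rfl
    exact hlp.ne ((hF p).1 ((hG p).2 ⟨hp, hpe⟩)).2
  · rintro rfl
    exact hlp'.ne ((hF p').1 ((hG' p').2 ⟨hp', hpe'⟩)).2
  · ext z
    rw [Set.mem_inter_iff, hG, hG', hF]
    simp only [add_apply, smul_apply, smul_eq_mul,
      neg_apply]
    constructor
    · rintro ⟨⟨hz, h1⟩, -, h2⟩
      refine ⟨hz, ?_⟩
      -- This combination of the two rotated equations eliminates `g`, and `s + s'` is positive.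
      have : (s + s') * (l z - l v) = 0 := by linear_combination s' * h1 + s * h2
      rcases mul_eq_zero.1 this with h3 | h3 <;> linarith
    · rintro ⟨hz, h1⟩
      have h2 : g z = g v := hg z ((hF z).2 ⟨hz, h1⟩) v hv
      exact ⟨⟨hz, by rw [h1, h2]⟩, hz, by rw [h1, h2]⟩

theorem mem_codimFaces {F P : Polytope E} {k : ℕ} :
    F ∈ P.codimFaces k ↔ F.IsFaceOf P ∧ F.dim + k = P.dim := by
  simp [codimFaces]

theorem mem_dimFaces {F P : Polytope E} {i : ℕ} :
    F ∈ P.dimFaces i ↔ F.IsFaceOf P ∧ F.dim = i := by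
  simp [dimFaces]

/-- Every face is the intersection of the facets containing it. -/
theorem IsFaceOf.exists_facet_notMem [FiniteDimensional ℝ E] {F P : Polytope E}
    (h : F.IsFaceOf P) {x : E} (hx : x ∈ P.carrier) (hxF : x ∉ F.carrier) :
    ∃ A ∈ P.codimFaces 1, F.carrier ⊆ A.carrier ∧ x ∉ A.carrier := by
  induction hn : P.dim - F.dim using Nat.strong_induction_on generalizing F with
  | _ n ih =>
    have hlt := dim_lt_of_isFaceOf_of_ne h (by rintro rfl; exact hxF hx)
    by_cases h1 : F.dim + 1 = P.dim
    · exact ⟨F, mem_codimFaces.2 ⟨h, h1⟩, subset_rfl, hxF⟩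
    -- The point `x` misses at least one of these two larger faces, to which the induction applies.
    · obtain ⟨G, G', hG, hG', hne, hne', hint⟩ := h.exists_inter_eq (by omega)
      have hsub : F.carrier ⊆ G.carrier := hint ▸ Set.inter_subset_left
      have hsub' : F.carrier ⊆ G'.carrier := hint ▸ Set.inter_subset_right
      have hd := dim_lt_of_isFaceOf_of_ne (h.mono hG hsub) hne.symm
      have hd' := dim_lt_of_isFaceOf_of_ne (h.mono hG' hsub') hne'.symm
      by_cases hxG : x ∈ G.carrier
      · have hxG' : x ∉ G'.carrier := fun hc => hxF (hint ▸ ⟨hxG, hc⟩)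
        obtain ⟨A, hA, hGA, hxA⟩ := ih _ (by omega) hG' hxG' rfl
        exact ⟨A, hA, hsub'.trans hGA, hxA⟩
      · obtain ⟨A, hA, hGA, hxA⟩ := ih _ (by omega) hG hxG rfl
        exact ⟨A, hA, hsub.trans hGA, hxA⟩

theorem exists_mem_dimFaces_zero [FiniteDimensional ℝ E] (P : Polytope E) :
    (P.dimFaces 0).Nonempty := by
  induction hn : P.dim using Nat.strong_induction_on generalizing P with
  | _ n ih =>
    by_cases h0 : P.dim = 0
    · exact ⟨P, mem_dimFaces.2 ⟨IsFaceOf.refl P, h0⟩⟩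
    · obtain ⟨F, hF, hne⟩ : ∃ F : Polytope E, F.IsFaceOf P ∧ F ≠ P := by
        obtain ⟨v, hv⟩ := P.nonempty
        obtain ⟨x, hx, hxv⟩ : ∃ x ∈ P.carrier, x ≠ v := by
          by_contra! hcon
          have : P.carrier = {v} := Set.eq_singleton_iff_unique_mem.2 ⟨hv, hcon⟩
          exact h0 (by simp [dim, this])
        obtain ⟨l, hl⟩ := SeparatingDual.exists_separating_of_ne (R := ℝ) hxv
        obtain ⟨w, hw, hmax⟩ := P.isCompact.exists_isMaxOn P.nonempty l.continuous.continuousOn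
        obtain ⟨F, hF, hFl⟩ := exists_isFaceOf l hw hmax
        refine ⟨F, hF, ?_⟩
        rintro rfl
        exact hl (((hFl x).1 hx).2.trans ((hFl v).1 hv).2.symm)
      obtain ⟨V, hV⟩ := ih _ (hn ▸ dim_lt_of_isFaceOf_of_ne hF hne) F rfl
      exact ⟨V, mem_dimFaces.2 ⟨(mem_dimFaces.1 hV).1.trans hF, (mem_dimFaces.1 hV).2⟩⟩

/-! ### Counting the facets through a face -/

noncomputable section

open scoped Classical in
/-- The facets of `P` containing `F`. -/
def facetsThrough (P F : Polytope E) : Finset (Polytope E) :=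
  {A ∈ P.codimFaces 1 | F.carrier ⊆ A.carrier}

theorem mem_facetsThrough {P F A : Polytope E} :
    A ∈ P.facetsThrough F ↔ A ∈ P.codimFaces 1 ∧ F.carrier ⊆ A.carrier := by
  simp [facetsThrough]

theorem facetsThrough_anti (P : Polytope E) {F G : Polytope E} (h : F.carrier ⊆ G.carrier) :
    P.facetsThrough G ⊆ P.facetsThrough F := fun A hA => by
  rw [mem_facetsThrough] at hA ⊢
  exact ⟨hA.1, h.trans hA.2⟩

theorem isSimple_iff {P : Polytope E} :
    P.IsSimple ↔ ∀ V ∈ P.dimFaces 0, (P.facetsThrough V).card = P.dim := by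
  have h : ∀ V : Polytope E, {F | F ∈ P.codimFaces 1 ∧ V.carrier ⊆ F.carrier} =
      (P.facetsThrough V : Set (Polytope E)) := fun V => by
    ext A; simp [mem_facetsThrough]
  simp only [IsSimple, h, Set.ncard_coe_finset]

/-- The finite set of all faces of a polytope. -/
def faces (P : Polytope E) : Finset (Polytope E) := P.finite_isFaceOf.toFinset

theorem mem_faces {F P : Polytope E} : F ∈ P.faces ↔ F.IsFaceOf P := by
  simp [faces]

section FacetCounting

variable [FiniteDimensional ℝ E]

theorem facetsThrough_self (P : Polytope E) : P.facetsThrough P = ∅ := by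
  refine Finset.eq_empty_of_forall_notMem fun A hA => ?_
  rw [mem_facetsThrough, mem_codimFaces] at hA
  have := Submodule.finrank_mono (vectorSpan_mono ℝ hA.2)
  have h2 : P.dim ≤ A.dim := this
  omega

theorem subset_of_facetsThrough_subset {P F G : Polytope E} (hF : F.IsFaceOf P)
    (hG : G.IsFaceOf P) (h : P.facetsThrough G ⊆ P.facetsThrough F) :
    F.carrier ⊆ G.carrier := by
  intro x hx
  by_contra hxG
  obtain ⟨A, hA, hGA, hxA⟩ := hG.exists_facet_notMem (hF.subset hx) hxG
  exact hxA ((mem_facetsThrough.1 (h (mem_facetsThrough.2 ⟨hA, hGA⟩))).2 hx)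

theorem facetsThrough_injOn {P F G : Polytope E} (hF : F.IsFaceOf P) (hG : G.IsFaceOf P)
    (h : P.facetsThrough F = P.facetsThrough G) : F = G :=
  Polytope.ext ((subset_of_facetsThrough_subset hF hG h.ge).antisymm
    (subset_of_facetsThrough_subset hG hF h.le))

theorem facetsThrough_ssubset {P F G : Polytope E} (hF : F.IsFaceOf G) (hG : G.IsFaceOf P)
    (hne : F ≠ G) : P.facetsThrough G ⊂ P.facetsThrough F :=
  (facetsThrough_anti P hF.subset).ssubset_of_ne
    fun h => hne (facetsThrough_injOn (hF.trans hG) hG h.symm)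

/-- Descending from `G` to a facet of `G` that contains `F` loses one dimension and gains at least
one facet of `P`; iterate down to `F`. -/
theorem card_facetsThrough_add_le {P F G : Polytope E} (hG : G.IsFaceOf P) (hF : F.IsFaceOf G) :
    (P.facetsThrough G).card + G.dim ≤ (P.facetsThrough F).card + F.dim := by
  induction hn : G.dim generalizing G with
  | zero =>
    have := Finset.card_le_card (facetsThrough_anti P hF.subset)
    omega
  | succ n ih =>
    by_cases hFG : F = G
    · subst hFG; omega
    · obtain ⟨x, hx, hxF⟩ : ∃ x ∈ G.carrier, x ∉ F.carrier := by
        by_contra! hcon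
        exact hFG (Polytope.ext (hF.subset.antisymm hcon))
      obtain ⟨K, hK, hFK, hxK⟩ := hF.exists_facet_notMem hx hxF
      rw [mem_codimFaces] at hK
      have h1 := ih (hK.1.trans hG) (hF.mono hK.1 hFK) (by omega)
      have h2 := Finset.card_lt_card
        (facetsThrough_ssubset hK.1 hG (by rintro rfl; exact hxK hx))
      omega

theorem dim_le_card_facetsThrough_add {P F : Polytope E} (hF : F.IsFaceOf P) :
    P.dim ≤ (P.facetsThrough F).card + F.dim := by
  simpa [facetsThrough_self] using card_facetsThrough_add_le (IsFaceOf.refl P) hF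

/-- The number of facets plus the dimension can only grow on passing to smaller faces. It is `dim P`
both at `P` and at a vertex of `F`, so it is `dim P` at `F`. -/
theorem IsSimple.card_facetsThrough_add {P F : Polytope E} (hP : P.IsSimple)
    (hF : F.IsFaceOf P) : (P.facetsThrough F).card + F.dim = P.dim := by
  obtain ⟨V, hV⟩ := exists_mem_dimFaces_zero F
  rw [mem_dimFaces] at hV
  have h1 := card_facetsThrough_add_le hF hV.1
  have h2 := isSimple_iff.1 hP V (mem_dimFaces.2 ⟨hV.1.trans hF, hV.2⟩)
  have h3 := dim_le_card_facetsThrough_add hF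
  omega

/-- In a simple polytope, cutting a face `G` by a further facet through `F` gives a facet of `G`. -/
theorem IsSimple.facetsThrough_image {P F G : Polytope E} (hP : P.IsSimple)
    (hG : G.IsFaceOf P) (hF : F.IsFaceOf G) :
    (G.facetsThrough F).card + F.dim = G.dim ∧
      ∀ A ∈ P.facetsThrough F, ∀ hAG : A ∉ P.facetsThrough G,
        ∃ K ∈ G.facetsThrough F, P.facetsThrough K = Finset.cons A (P.facetsThrough G) hAG := by
  classical
  -- Each facet `K` of `G` lies in exactly one facet of `P` not containing `G`. This assignment is
  -- injective, and the lower bound on the facets of `G` through `F` makes it bijective.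
  have hex : ∀ K ∈ G.facetsThrough F, ∃ A, A ∈ P.facetsThrough F \ P.facetsThrough G ∧
      P.facetsThrough K = insert A (P.facetsThrough G) := by
    intro K hK
    rw [mem_facetsThrough, mem_codimFaces] at hK
    have h1 := hP.card_facetsThrough_add hG
    have h2 := hP.card_facetsThrough_add (hK.1.1.trans hG)
    have hsub := facetsThrough_anti P hK.1.1.subset
    obtain ⟨A, hA⟩ := Finset.card_eq_one.1 (show (P.facetsThrough K \ P.facetsThrough G).card = 1 by
      rw [Finset.card_sdiff_of_subset hsub]; have := hK.1.2; omega)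
    have hA' : A ∈ P.facetsThrough K \ P.facetsThrough G := by simp [hA]
    rw [Finset.mem_sdiff] at hA'
    refine ⟨A, Finset.mem_sdiff.2 ⟨facetsThrough_anti P hK.2 hA'.1, hA'.2⟩, ?_⟩
    rw [Finset.insert_eq, ← hA, Finset.sdiff_union_of_subset hsub]
  choose! f hf hfK using hex
  have hinj : Set.InjOn f (G.facetsThrough F) := by
    intro K hK K' hK' h
    have e1 := hfK K hK
    have e2 := hfK K' hK'
    simp only [Finset.mem_coe, mem_facetsThrough, mem_codimFaces] at hK hK'
    exact facetsThrough_injOn (hK.1.1.trans hG) (hK'.1.1.trans hG) (by rw [e1, e2, h])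
  have hsub := facetsThrough_anti P hF.subset
  have hcard : (P.facetsThrough F \ P.facetsThrough G).card + F.dim = G.dim := by
    rw [Finset.card_sdiff_of_subset hsub]
    have h1 := hP.card_facetsThrough_add hG
    have h2 := hP.card_facetsThrough_add (hF.trans hG)
    have h3 := Finset.card_le_card hsub
    omega
  have hge := dim_le_card_facetsThrough_add hF
  have hle := Finset.card_le_card_of_injOn f hf hinj
  refine ⟨by omega, fun A hA hAG => ?_⟩
  obtain ⟨K, hK, rfl⟩ := Finset.surj_on_of_inj_on_of_card_le (fun K _ => f K) hf
    (fun a b ha hb h => hinj ha hb h) (by omega) A (Finset.mem_sdiff.2 ⟨hA, hAG⟩)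
  exact ⟨K, hK, by rw [hfK K hK, Finset.cons_eq_insert]⟩

theorem IsSimple.of_isFaceOf {P G : Polytope E} (hP : P.IsSimple) (hG : G.IsFaceOf P) :
    G.IsSimple := by
  rw [isSimple_iff]
  intro V hV
  rw [mem_dimFaces] at hV
  have := (hP.facetsThrough_image hG hV.1).1
  omega

/-- In a simple polytope, every set of facets through a face `F` is the set of all facets through
some face containing `F`. -/
theorem IsSimple.exists_facetsThrough_eq {P F : Polytope E} (hP : P.IsSimple)
    (hF : F.IsFaceOf P) (T : Finset (Polytope E)) (hT : T ⊆ P.facetsThrough F) :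
    ∃ G : Polytope E, G.IsFaceOf P ∧ F.carrier ⊆ G.carrier ∧ P.facetsThrough G = T := by
  induction T using Finset.cons_induction with
  | empty => exact ⟨P, IsFaceOf.refl P, hF.subset, facetsThrough_self P⟩
  | cons A T hA ih =>
    obtain ⟨G, hG, hFG, rfl⟩ := ih ((Finset.subset_cons hA).trans hT)
    obtain ⟨K, hK, hKA⟩ := (hP.facetsThrough_image hG (hF.mono hG hFG)).2 A
      (hT (Finset.mem_cons_self _ _)) hA
    rw [mem_facetsThrough, mem_codimFaces] at hK
    exact ⟨K, hK.1.1.trans hG, hK.2, hKA⟩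

open scoped Classical in
-- `G ↦ P.facetsThrough G` is a bijection from the faces containing `F` to the subsets of
-- `P.facetsThrough F`, so this is the binomial theorem summed over subsets.
theorem IsSimple.sum_pow_mul_pow {R : Type*} [CommRing R] {P F : Polytope E} (hP : P.IsSimple)
    (hF : F.IsFaceOf P) (t s : R) :
    ∑ G ∈ P.faces with F.carrier ⊆ G.carrier, t ^ (P.dim - G.dim) * s ^ (G.dim - F.dim) =
      (t + s) ^ (P.dim - F.dim) := by
  have hk : P.dim - F.dim = (P.facetsThrough F).card := by
    have := hP.card_facetsThrough_add hF
    omega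
  rw [hk, ← Finset.sum_pow_mul_eq_add_pow]
  refine Finset.sum_bij (fun G _ => P.facetsThrough G) ?_ ?_ ?_ ?_
  · intro G hG
    rw [Finset.mem_filter] at hG
    exact Finset.mem_powerset.2 (facetsThrough_anti P hG.2)
  · intro G hG G' hG' h
    rw [Finset.mem_filter, mem_faces] at hG hG'
    exact facetsThrough_injOn hG.1 hG'.1 h
  · intro T hT
    obtain ⟨G, hG, hFG, rfl⟩ := hP.exists_facetsThrough_eq hF T (Finset.mem_powerset.1 hT)
    exact ⟨G, Finset.mem_filter.2 ⟨mem_faces.2 hG, hFG⟩, rfl⟩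
  · intro G hG
    rw [Finset.mem_filter, mem_faces] at hG
    have h1 := hP.card_facetsThrough_add hG.1
    have h2 := hP.card_facetsThrough_add hF
    have h3 := Finset.card_le_card (facetsThrough_anti P hG.2)
    congr 2 <;> omega

end FacetCounting

/-! ### Sums over flags of faces -/

/-- The value `ξ_α Φ(t_m) ⋯ Φ(t₁) P` for a list `t₁, …, t_m` of elements of a ring. -/
def flagSum {R : Type*} [CommRing R] (α : R) : List R → Polytope E → R
  | [], P => α ^ P.dim
  | t :: L, P => ∑ F ∈ P.faces, t ^ (P.dim - F.dim) * flagSum α L F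

theorem map_flagSum {R S : Type*} [CommRing R] [CommRing S] (φ : R →+* S) (α : R) (L : List R)
    (P : Polytope E) : φ (flagSum α L P) = flagSum (φ α) (L.map φ) P := by
  induction L generalizing P with
  | nil => simp [flagSum]
  | cons t L ih => simp [flagSum, ih]

theorem flagSum_singleton {R : Type*} [CommRing R] (α t : R) (P : Polytope E) :
    flagSum α [t] P = ∑ F ∈ P.faces, t ^ (P.dim - F.dim) * α ^ F.dim := rfl

theorem flagSum_pair {R : Type*} [CommRing R] (α t s : R) (P : Polytope E) :
    flagSum α [t, s] P = ∑ F ∈ P.faces, t ^ (P.dim - F.dim) * flagSum α [s] F := rfl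

open scoped Classical in
theorem flagSum_pair_eq_sum {R : Type*} [CommRing R] (α t s : R) (P : Polytope E) :
    flagSum α [t, s] P = ∑ F ∈ P.faces, (∑ G ∈ P.faces with F.carrier ⊆ G.carrier,
      t ^ (P.dim - G.dim) * s ^ (G.dim - F.dim)) * α ^ F.dim := by
  simp only [flagSum_pair, flagSum_singleton, Finset.mul_sum, Finset.sum_mul]
  rw [Finset.sum_comm' (t' := P.faces)
    (s' := fun F => {G ∈ P.faces | F.carrier ⊆ G.carrier})]
  · exact Finset.sum_congr rfl fun F _ => Finset.sum_congr rfl fun G _ => by ring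
  · intro G F
    simp only [Finset.mem_filter, mem_faces]
    exact ⟨fun ⟨hG, hF⟩ => ⟨⟨hG, hF.subset⟩, hF.trans hG⟩,
      fun ⟨⟨hG, hFG⟩, hF⟩ => ⟨hG, hF.mono hG hFG⟩⟩

open Polynomial in
/-- The incidences of vertices and facets are counted by the linear coefficient of `f₂(0, t, 1)`. -/
theorem sum_card_facetsThrough (P : Polytope E) :
    (flagSum (0 : ℤ[X]) [X, 1] P).coeff 1 =
      ∑ V ∈ P.dimFaces 0, ((P.facetsThrough V).card : ℤ) := by
  classical
  have h0 : P.dimFaces 0 = {F ∈ P.faces | F.dim = 0} := by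
    ext F
    rw [mem_dimFaces, Finset.mem_filter, mem_faces]
  rw [flagSum_pair_eq_sum, finsetSum_coeff, h0, Finset.sum_filter]
  refine Finset.sum_congr rfl fun V _ => ?_
  split_ifs with hV
  · rw [hV, pow_zero, mul_one, finsetSum_coeff]
    simp only [one_pow, mul_one, coeff_X_pow, Finset.sum_boole]
    congr 2
    ext A
    simp only [Finset.mem_filter, mem_facetsThrough, mem_codimFaces, mem_faces]
    constructor
    · rintro ⟨⟨h1, h2⟩, h3⟩
      exact ⟨⟨h1, by omega⟩, h2⟩
    · rintro ⟨⟨h1, h2⟩, h3⟩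
      exact ⟨⟨h1, h3⟩, by omega⟩
  · simp [zero_pow hV]

open Polynomial in
-- At `α = 0` only vertices survive, each contributing `(X + 1) ^ dim P`.
theorem coeff_one_flagSum_X_add_one (P : Polytope E) :
    (flagSum (0 : ℤ[X]) [X + 1] P).coeff 1 = ∑ _V ∈ P.dimFaces 0, (P.dim : ℤ) := by
  classical
  have h0 : P.dimFaces 0 = {F ∈ P.faces | F.dim = 0} := by
    ext F
    rw [mem_dimFaces, Finset.mem_filter, mem_faces]
  rw [flagSum_singleton, finsetSum_coeff, h0, Finset.sum_filter]
  refine Finset.sum_congr rfl fun V _ => ?_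
  split_ifs with hV
  · simp [hV, coeff_X_add_one_pow]
  · simp [zero_pow hV]

/-! ### From the operators to flag sums, and the two implications -/

variable [FiniteDimensional ℝ E]

theorem Phi_single {R : Type*} [CommRing R] (t : R) (P : Polytope E) :
    Phi t (Finsupp.single P 1) =
      ∑ F ∈ P.faces, t ^ (P.dim - F.dim) • Finsupp.single F (1 : R) := by
  classical
  have hmaps : ∀ F ∈ P.faces, P.dim - F.dim ∈ Finset.range (Module.finrank ℝ E + 1) := by
    intro F _
    have : P.dim ≤ Module.finrank ℝ E := Submodule.finrank_le _
    rw [Finset.mem_range]; omega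
  rw [← Finset.sum_fiberwise_of_maps_to hmaps]
  simp only [Phi, LinearMap.sum_apply, LinearMap.smul_apply, d, Finsupp.linearCombination_single,
    one_smul, Finset.smul_sum]
  refine Finset.sum_congr rfl fun k _ => ?_
  have : P.codimFaces k = {F ∈ P.faces | P.dim - F.dim = k} := by
    ext F
    rw [mem_codimFaces, Finset.mem_filter, mem_faces]
    refine and_congr_right fun h => ?_
    have := dim_le_of_isFaceOf h
    omega
  rw [this]
  refine Finset.sum_congr rfl fun F hF => ?_
  rw [(Finset.mem_filter.1 hF).2]

theorem xi_prod_Phi {R : Type*} [CommRing R] (α : R) (L : List R) (P : Polytope E) :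
    xi α ((L.map (Phi (E := E))).reverse.prod (Finsupp.single P 1)) = flagSum α L P := by
  induction L generalizing P with
  | nil => simp [flagSum, xi]
  | cons t L ih =>
    simp only [List.map_cons, List.reverse_cons, List.prod_append, List.prod_singleton,
      Module.End.mul_apply, Phi_single, map_sum, map_smul, ih, flagSum, smul_eq_mul]

theorem genFPoly_eq_flagSum (m : ℕ) (P : Polytope E) :
    genFPoly m P =
      flagSum (MvPolynomial.X 0) (List.ofFn fun i : Fin m => MvPolynomial.X i.succ) P := by
  rw [← xi_prod_Phi, List.map_ofFn]; rfl

/-- This is `Φ(0) = id`: since `0 ^ 0 = 1`, only `P` itself contributes. -/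
theorem sum_faces_zero_pow {R : Type*} [CommRing R] (P : Polytope E) (f : Polytope E → R) :
    ∑ F ∈ P.faces, 0 ^ (P.dim - F.dim) * f F = f P := by
  rw [Finset.sum_eq_single P]
  · simp
  · intro F hF hne
    have := dim_lt_of_isFaceOf_of_ne (mem_faces.1 hF) hne
    rw [zero_pow (by omega), zero_mul]
  · intro h
    exact absurd (mem_faces.2 (IsFaceOf.refl P)) h

theorem flagSum_of_forall_eq_zero {R : Type*} [CommRing R] (α : R) (L : List R)
    (hL : ∀ t ∈ L, t = 0) (P : Polytope E) : flagSum α L P = α ^ P.dim := by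
  induction L generalizing P with
  | nil => rfl
  | cons t L ih =>
    rw [List.forall_mem_cons] at hL
    rw [flagSum, hL.1, sum_faces_zero_pow, ih hL.2]

/-- Faces of `P` are simple, so induction merges the tail of the list into its sum; the binomial
identity then absorbs the head. -/
theorem IsSimple.flagSum_eq {R : Type*} [CommRing R] {P : Polytope E} (hP : P.IsSimple)
    (α : R) (L : List R) : flagSum α L P = flagSum α [L.sum] P := by
  induction L generalizing P with
  | nil => rw [List.sum_nil, flagSum_of_forall_eq_zero α [0] (by simp), flagSum]
  | cons t L ih =>
    have h : flagSum α (t :: L) P = flagSum α [t, L.sum] P := by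
      rw [flagSum_pair, flagSum]
      exact Finset.sum_congr rfl fun F hF => by rw [ih (hP.of_isFaceOf (mem_faces.1 hF))]
    rw [h, flagSum_pair_eq_sum, flagSum_singleton, List.sum_cons]
    exact Finset.sum_congr rfl fun F hF => by rw [hP.sum_pow_mul_pow (mem_faces.1 hF)]

theorem substSum_genFPoly_one (m : ℕ) (P : Polytope E) :
    substSum m (genFPoly 1 P) = flagSum (MvPolynomial.X 0)
      [(List.ofFn fun i : Fin m => (MvPolynomial.X i.succ : MvPolynomial (Fin (m + 1)) ℤ)).sum]
        P := by
  rw [genFPoly_eq_flagSum]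
  have := map_flagSum (substSum m).toRingHom (MvPolynomial.X 0)
    (List.ofFn fun i : Fin 1 => MvPolynomial.X i.succ) P
  refine this.trans ?_
  simp [substSum, List.sum_ofFn]

theorem genFPoly_one (P : Polytope E) : genFPoly 1 P = homFPoly P := by
  classical
  rw [genFPoly_eq_flagSum]
  simp only [List.ofFn_succ, List.ofFn_zero, flagSum_singleton, homFPoly]
  have hmaps : ∀ F ∈ P.faces, F.dim ∈ Finset.range (P.dim + 1) := by
    intro F hF
    have := dim_le_of_isFaceOf (mem_faces.1 hF)
    rw [Finset.mem_range]; omega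
  rw [← Finset.sum_fiberwise_of_maps_to hmaps]
  refine Finset.sum_congr rfl fun i _ => ?_
  have : P.dimFaces i = {F ∈ P.faces | F.dim = i} := by
    ext F
    rw [mem_dimFaces, Finset.mem_filter, mem_faces]
  rw [this, Finset.sum_congr rfl (g := fun _ => MvPolynomial.X 1 ^ (P.dim - i) *
    MvPolynomial.X 0 ^ i) fun F hF => by rw [(Finset.mem_filter.1 hF).2]; rfl]
  simp only [Finset.sum_const, nsmul_eq_mul, map_natCast]
  ring

open Polynomial in
theorem isSimple_of_flagSum_eq {P : Polytope E}
    (h : flagSum (0 : ℤ[X]) [X, 1] P = flagSum 0 [X + 1] P) : P.IsSimple := by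
  have h1 := congrArg (fun p => p.coeff 1) h
  simp only [sum_card_facetsThrough, coeff_one_flagSum_X_add_one] at h1
  have h2 : ∑ V ∈ P.dimFaces 0, P.dim = ∑ V ∈ P.dimFaces 0, (P.facetsThrough V).card := by
    exact_mod_cast h1.symm
  have hle : ∀ V ∈ P.dimFaces 0, P.dim ≤ (P.facetsThrough V).card := fun V hV => by
    rw [mem_dimFaces] at hV
    have := dim_le_card_facetsThrough_add hV.1
    omega
  exact isSimple_iff.2 fun V hV => ((Finset.sum_eq_sum_iff_of_le hle).1 h2 V hV).symm

open Polynomial in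
theorem isSimple_of_genFPoly_eq {k : ℕ} {P : Polytope E}
    (h : genFPoly (k + 2) P = substSum (k + 2) (genFPoly 1 P)) : P.IsSimple := by
  -- Specialize `α = 0`, `t₁ = X`, `t₂ = 1`; the remaining variables become `0`, so their operators
  -- are the identity.
  let w : Fin (k + 3) → ℤ[X] := Fin.cons 0 (Fin.cons X (Fin.cons 1 fun _ => 0))
  have h1 := congrArg (MvPolynomial.aeval w).toRingHom h
  rw [substSum_genFPoly_one, genFPoly_eq_flagSum, map_flagSum, map_flagSum] at h1
  have hw0 : (MvPolynomial.aeval w).toRingHom (MvPolynomial.X 0 : MvPolynomial _ ℤ) = 0 := by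
    simp [w]
  have hL : (List.ofFn fun i : Fin (k + 2) => (MvPolynomial.X i.succ :
      MvPolynomial (Fin (k + 2 + 1)) ℤ)).map (MvPolynomial.aeval w).toRingHom =
      X :: 1 :: List.replicate k 0 := by
    rw [List.map_ofFn, List.ofFn_succ, List.ofFn_succ]
    have h2 : ∀ i : Fin k, w i.succ.succ.succ = 0 := fun i => rfl
    have h3 : w (Fin.succ 0) = X := rfl
    have h4 : w (Fin.succ (Fin.succ 0)) = 1 := rfl
    simp only [Function.comp_apply, AlgHom.toRingHom_eq_coe, RingHom.coe_coe,
      MvPolynomial.aeval_X, h2, h3, h4, List.ofFn_const]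
  rw [hw0, hL, List.map_singleton, map_list_sum, hL] at h1
  have hs : (X :: 1 :: List.replicate k (0 : ℤ[X])).sum = X + 1 := by simp
  rw [hs] at h1
  refine isSimple_of_flagSum_eq (Eq.trans ?_ h1)
  simp only [flagSum]
  refine Finset.sum_congr rfl fun F _ => ?_
  congr 1
  refine Finset.sum_congr rfl fun G _ => ?_
  rw [flagSum_of_forall_eq_zero _ _ fun t ht => List.eq_of_mem_replicate ht]

end

end Polytope

theorem proposition19 {E : Type*} [NormedAddCommGroup E] [NormedSpace ℝ E]
    [FiniteDimensional ℝ E] (m : ℕ) (hm : 2 ≤ m) (P : Polytope E) :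
    Polytope.genFPoly 1 P = Polytope.homFPoly P ∧
      (Polytope.genFPoly m P = Polytope.substSum m (Polytope.genFPoly 1 P) ↔ P.IsSimple) := by
  refine ⟨Polytope.genFPoly_one P, fun h => ?_, fun hP => ?_⟩
  · obtain ⟨k, rfl⟩ := Nat.exists_eq_add_of_le' hm
    exact Polytope.isSimple_of_genFPoly_eq h
  · rw [Polytope.substSum_genFPoly_one, Polytope.genFPoly_eq_flagSum, hP.flagSum_eq]
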